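/- Let $\mathcal W$ be a unary non-negative weighted automaton, that is, a finite set $Q$ of states, a matrix $A\in\mathbb R_{\ge 0}^{Q\times Q}$ of transition weights, and a final state $f\in Q$. A path of length $n$ from $s$ to $t$ is a sequence $q_0=s,q_1,\dots,q_n=t$ of states with $A_{q_{i-1},q_i}>0$ for $1\le i\le n$. The strongly connected component (SCC) of a state $q$ is the set of all states that are reachable from $q$ and from which $q$ is reachable (by paths of any length $\ge 0$). The spectral radius of an SCC $\varphi$ is the largest absolute value of a complex eigenvalue of the submatrix of $A$ with rows and columns indexed by $\varphi$. For $s,t\in Q$ define the degree function $d_{s,t}:\mathbb N\to\mathbb R\times\mathbb N$, $d_{s,t}(n)=(\rho(n),k(n))$, as follows. If there is a path of length $n$ from $s$ to $t$, then $\rho(n)$ is the largest spectral radius of an SCC visited by some path of length $n$ from $s$ to $t$, and $k(n)+1$ is the largest number of distinct SCCs of spectral radius $\rho(n)$ that a single path of length $n$ from $s$ to $t$ visits. If there is no such path, then $(\rho(n),k(n))=(0,0)$. Order $\mathbb R\times\mathbb N$ lexicographically. (1) For all $s,t\in Q$ there are constants $c,C>0$ such that, for every $n>|Q|$, $$c\cdot\rho(n)^n\,n^{k(n)}\;\le\;(A^n)_{s,t}\;\le\;C\cdot\rho(n)^n\,n^{k(n)},\qquad\text{where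 }(\rho(n),k(n))=d_{s,t}(n).$$ (2) For all $s,s'\in Q$ the following are equivalent: (i) $s$ is big-O of $s'$, i.e. there is $C>0$ such that $(A^n)_{s,f}\le C\,(A^n)_{s',f}$ for every $n\ge 0$; (ii) the language containment (LC) condition holds, i.e. for every $n\ge 0$, if $(A^n)_{s,f}>0$ then $(A^n)_{s',f}>0$; and $d_{s,f}(n)\le d_{s',f}(n)$ for all but finitely many $n\in\mathbb N$. -/

import Mathlib

/-- A unary non-negative weighted automaton with finite state set `Q`: its transition matrix `A`,
with non-negative (real) weights, and its unique final state. -/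
structure UnaryWeightedAutomaton (Q : Type*) where
  /-- the transition matrix; `A q q'` is the weight of the transition from `q` to `q'` -/
  A : Matrix Q Q ℝ
  nonneg : ∀ q q', 0 ≤ A q q'
  /-- the unique final state -/
  final : Q

namespace UnaryWeightedAutomaton

variable {Q : Type*}

/-- `p 0, p 1, …, p n` is a path of length `n` from `s` to `t` along transitions of non-zero
(that is, positive) weight. States may repeat. -/
def IsPath (W : UnaryWeightedAutomaton Q) (s t : Q) (n : ℕ) (p : Fin (n + 1) → Q) : Prop :=
  p 0 = s ∧ p (Fin.last n) = t ∧ ∀ i : Fin n, 0 < W.A (p i.castSucc) (p i.succ)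

/-- `q` can reach `q'`: there is a path, possibly of length `0`, from `q` to `q'`. -/
def Reaches (W : UnaryWeightedAutomaton Q) (q q' : Q) : Prop :=
  ∃ (n : ℕ) (p : Fin (n + 1) → Q), W.IsPath q q' n p

/-- The strongly connected component of the state `q`. -/
def scc (W : UnaryWeightedAutomaton Q) (q : Q) : Set Q :=
  {q' | W.Reaches q q' ∧ W.Reaches q' q}

open Classical in
/-- The spectral radius (largest absolute value of a complex eigenvalue) of the square submatrix
of the transition matrix on the set of states `φ`. -/
noncomputable def radius [Fintype Q] (W : UnaryWeightedAutomaton Q) (φ : Set Q) : ℝ :=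
  (spectralRadius ℂ
    ((W.A.submatrix (fun q : φ => (q : Q)) (fun q : φ => (q : Q))).map Complex.ofReal)).toReal

/-- The set of strongly connected components visited by `p`. -/
def visited (W : UnaryWeightedAutomaton Q) {n : ℕ} (p : Fin (n + 1) → Q) : Set (Set Q) :=
  Set.range fun i => W.scc (p i)

/-- The largest spectral radius of (the component of) any state visited on any path of length `n`
from `s` to `t`. The supremum is over a finite set, which is non-empty if there is such a path. -/
noncomputable def maxRadius [Fintype Q] (W : UnaryWeightedAutomaton Q) (s t : Q) (n : ℕ) : ℝ :=
  sSup {r | ∃ p, W.IsPath s t n p ∧ ∃ φ ∈ W.visited p, r = W.radius φ}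

/-- The largest number of components of spectral radius `ρ` visited by a single path of length `n`
from `s` to `t`. -/
noncomputable def maxCount [Fintype Q] (W : UnaryWeightedAutomaton Q) (s t : Q) (n : ℕ) (ρ : ℝ) :
    ℕ :=
  sSup {m | ∃ p, W.IsPath s t n p ∧ m = {φ ∈ W.visited p | W.radius φ = ρ}.ncard}

open Classical in
/-- The degree function `d_{s,t}`. If there is a path of length `n` from `s` to `t`, its value at
`n` is `(ρ, k)`, where `ρ` is the largest spectral radius met on such paths and `k + 1` is the
largest number of components of spectral radius `ρ` on a single such path (this number is at
least `1`, so the subtraction is not truncated). Otherwise it is `(0, 0)`. -/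
noncomputable def degree [Fintype Q] (W : UnaryWeightedAutomaton Q) (s t : Q) (n : ℕ) : ℝ × ℕ :=
  if ∃ p, W.IsPath s t n p then
    (W.maxRadius s t n, W.maxCount s t n (W.maxRadius s t n) - 1)
  else (0, 0)

/-- `ν_s(a ^ n)`, the weight from the state `s` of the unique word of length `n`. -/
def weight [Fintype Q] [DecidableEq Q] (W : UnaryWeightedAutomaton Q) (s : Q) (n : ℕ) : ℝ :=
  (W.A ^ n) s W.final

/-- `s` is big-O of `s'`. -/
def IsBigO [Fintype Q] [DecidableEq Q] (W : UnaryWeightedAutomaton Q) (s s' : Q) : Prop :=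
  ∃ C : ℝ, 0 < C ∧ ∀ n : ℕ, W.weight s n ≤ C * W.weight s' n

/-- The language containment condition for `s` and `s'`. -/
def LC [Fintype Q] [DecidableEq Q] (W : UnaryWeightedAutomaton Q) (s s' : Q) : Prop :=
  ∀ n : ℕ, 0 < W.weight s n → 0 < W.weight s' n

end UnaryWeightedAutomaton

/-!
Everything rests on the growth of powers inside one strongly connected component of spectral radius
`r`. Return weights `(A ^ n) a a` are supermultiplicative, so Gelfand's formula gives
`(A ^ n) a a ≤ r ^ n` outright (`Matrix.pow_apply_self_le_spectralRadius_pow`), hence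
`(A ^ n) a b ≤ C * r ^ n` for `a`, `b` in the component. Conversely the operator norm is
submultiplicative, so some entry of `A ^ n` on the component is at least a constant times `r ^ n`;
completing it to a closed path and filling the gaps gives `c * r ^ n ≤ (A ^ n) a a` whenever `n` is
a multiple of the length of a closed path at `a` (`exists_le_pow_mul_apply_self`). Neither
Perron–Frobenius eigenvectors nor the periods of the components are needed.

For the lower bound in terms of the degree, let `P` be a length of closed paths common to all
non-trivial components. A path which visits `K + 1` components of radius `ρ` is pumped by closed
paths of length `P` at these components; distributing `j` of them gives a binomial coefficient, of
order `j ^ K` (`HasTrace.exists_choose_mul_le`). Different distributions may be added up because a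
transition between two components is taken at most once (`sum_pow_mul_pow_le`). Given end points, a
set of visited components and a residue class modulo `P`, only the shortest such path has to be
pumped, which makes the constant independent of the length (`exists_lower_bound`).

For the upper bound, the weight is split according to the time at which the first component is left
(`pow_apply_le_sum_exitMatrix`), and the bound follows by induction on the number of reachable
states, each component contributing a convolution with `r ^ n` (`exists_upper_bound_step`). The
constraints on the visited components are those of the given length `n`, and they are inherited by
the remaining part of each path.

The characterization of big-O follows from these bounds, since the degree takes finitely many values
and `ρ ^ n * n ^ k` grows strictly with `(ρ, k)` in the lexicographic order.
-/

/-! ### Uniform constants and powers of non-negative matrices -/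

theorem Finite.exists_pos_le {ι : Type*} [Finite ι] (f : ι → ℝ) (hf : ∀ i, 0 < f i) :
    ∃ c, 0 < c ∧ ∀ i, c ≤ f i := by
  obtain ⟨⟨c, hc⟩, h⟩ := Finite.exists_ge fun i => (⟨f i, hf i⟩ : Set.Ioi (0 : ℝ))
  exact ⟨c, hc, h⟩

theorem Finite.exists_pos_ge {ι : Type*} [Finite ι] (f : ι → ℝ) :
    ∃ C, 0 < C ∧ ∀ i, f i ≤ C := by
  obtain ⟨C, h⟩ := Finite.exists_le f
  exact ⟨max C 1, by positivity, fun i => (h i).trans (le_max_left _ _)⟩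

section NonnegMatrix

variable {ι : Type*} [Fintype ι] [DecidableEq ι] {M : Matrix ι ι ℝ}

theorem Matrix.pow_apply_mul_le (hM : ∀ i j, 0 ≤ M i j) (m n : ℕ) (i j k : ι) :
    (M ^ m) i j * (M ^ n) j k ≤ (M ^ (m + n)) i k := by
  rw [pow_add, Matrix.mul_apply]
  exact Finset.single_le_sum (f := fun j => (M ^ m) i j * (M ^ n) j k)
    (fun l _ => mul_nonneg (pow_apply_nonneg hM m i l) (pow_apply_nonneg hM n l k))
    (Finset.mem_univ j)

theorem Matrix.pow_apply_self_pow_le (hM : ∀ i j, 0 ≤ M i j) (m k : ℕ) (i : ι) :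
    (M ^ m) i i ^ k ≤ (M ^ (m * k)) i i := by
  induction k with
  | zero => simp
  | succ k ih =>
    rw [pow_succ, Nat.mul_succ]
    exact (mul_le_mul_of_nonneg_right ih (pow_apply_nonneg hM m i i)).trans
      (pow_apply_mul_le hM _ _ i i i)

-- The spectral radius does not depend on a norm; the operator norm for the supremum norm is one for
-- which complex matrices are a Banach algebra, as Gelfand's formula requires.
attribute [local instance] Matrix.linftyOpNormedRing Matrix.linftyOpNormedAlgebra

theorem Matrix.norm_apply_le_linfty (N : Matrix ι ι ℂ) (i j : ι) : ‖N i j‖₊ ≤ ‖N‖₊ := by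
  rw [Matrix.linfty_opNNNorm_def]
  exact (Finset.single_le_sum (f := fun j => ‖N i j‖₊) (fun _ _ => zero_le)
    (Finset.mem_univ j)).trans (Finset.le_sup (f := fun i => ∑ j, ‖N i j‖₊) (Finset.mem_univ i))

theorem Matrix.linfty_norm_le_sum (N : Matrix ι ι ℂ) : ‖N‖₊ ≤ ∑ i, ∑ j, ‖N i j‖₊ := by
  rw [Matrix.linfty_opNNNorm_def]
  exact Finset.sup_le fun i _ => Finset.single_le_sum (f := fun i => ∑ j, ‖N i j‖₊)
    (fun _ _ => zero_le) (Finset.mem_univ i)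

theorem Matrix.map_ofReal_pow (M : Matrix ι ι ℝ) (n : ℕ) :
    M.map Complex.ofReal ^ n = (M ^ n).map Complex.ofReal :=
  (map_pow (Complex.ofRealHom.mapMatrix (m := ι)) M n).symm

theorem Matrix.spectralRadius_ne_top (N : Matrix ι ι ℂ) : spectralRadius ℂ N ≠ ⊤ := by
  cases isEmpty_or_nonempty ι
  · simp
  · exact ne_top_of_le_ne_top ENNReal.coe_ne_top (spectrum.spectralRadius_le_nnnorm N)

/-- Diagonal entries of powers are supermultiplicative, so that Gelfand's formula bounds each of
them by the power of the spectral radius, without any constant. -/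
theorem Matrix.pow_apply_self_le_spectralRadius_pow (hM : ∀ i j, 0 ≤ M i j) (n : ℕ) (i : ι) :
    (M ^ n) i i ≤ (spectralRadius ℂ (M.map Complex.ofReal)).toReal ^ n := by
  rcases Nat.eq_zero_or_pos n with rfl | hn
  · simp
  set x := (M ^ n) i i with hx
  have hx0 : 0 ≤ x := pow_apply_nonneg hM n i i
  set ρ := spectralRadius ℂ (M.map Complex.ofReal) with hρ
  have hlim := (spectrum.pow_nnnorm_pow_one_div_tendsto_nhds_spectralRadius
    (M.map Complex.ofReal)).comp (Filter.tendsto_id.const_mul_atTop' hn)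
  have hroot : (ENNReal.ofReal x) ^ (1 / n : ℝ) ≤ ρ := by
    refine ge_of_tendsto hlim ?_
    filter_upwards [Filter.eventually_ge_atTop 1] with k hk
    have hk' : (k : ℝ) ≠ 0 := by positivity
    have hn' : (n : ℝ) ≠ 0 := by positivity
    have h1 : x.toNNReal ^ k ≤ ‖M.map Complex.ofReal ^ (n * k)‖₊ := by
      refine le_trans ?_ (norm_apply_le_linfty _ i i)
      rw [map_ofReal_pow, ← NNReal.coe_le_coe]
      simp only [NNReal.coe_pow, Real.coe_toNNReal x hx0, Matrix.map_apply, coe_nnnorm,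
        Complex.norm_real]
      rw [Real.norm_of_nonneg (pow_apply_nonneg hM _ i i)]
      exact pow_apply_self_pow_le hM n k i
    have h2 : (ENNReal.ofReal x) ^ (1 / n : ℝ) =
        ((ENNReal.ofReal x) ^ k) ^ (1 / ((n * k : ℕ) : ℝ)) := by
      rw [← ENNReal.rpow_natCast, ← ENNReal.rpow_mul]
      congr 1
      push_cast
      field_simp
    simp only [Function.comp_apply, id]
    rw [h2]
    refine ENNReal.rpow_le_rpow ?_ (by positivity)
    rw [ENNReal.ofReal]
    exact_mod_cast h1
  have h3 : ENNReal.ofReal x ≤ ρ ^ n := by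
    have := pow_le_pow_left' hroot n
    rwa [← ENNReal.rpow_natCast, ← ENNReal.rpow_mul, one_div, inv_mul_cancel₀ (by positivity),
      ENNReal.rpow_one] at this
  have h4 := ENNReal.toReal_mono (ENNReal.pow_ne_top (spectralRadius_ne_top _)) h3
  rwa [ENNReal.toReal_ofReal hx0, ENNReal.toReal_pow] at h4

/-- The operator norm is submultiplicative, so that the spectral radius bounds the sum of the
entries of each power from below, without any constant. -/
theorem Matrix.spectralRadius_pow_le_sum [Nonempty ι] (hM : ∀ i j, 0 ≤ M i j) (n : ℕ) :
    (spectralRadius ℂ (M.map Complex.ofReal)).toReal ^ n ≤ ∑ i, ∑ j, (M ^ n) i j := by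
  have h1 : spectralRadius ℂ (M.map Complex.ofReal) ^ n ≤
      ((∑ i, ∑ j, ‖(M.map Complex.ofReal ^ n) i j‖₊ : NNReal) : ENNReal) :=
    (spectrum.spectralRadius_pow_le' _ n).trans <|
      (spectrum.spectralRadius_le_nnnorm _).trans <| by
        exact_mod_cast linfty_norm_le_sum (M.map Complex.ofReal ^ n)
  have h2 := ENNReal.toReal_mono ENNReal.coe_ne_top h1
  rw [ENNReal.toReal_pow, ENNReal.coe_toReal] at h2
  refine h2.trans (le_of_eq ?_)
  push_cast
  refine Finset.sum_congr rfl fun i _ => Finset.sum_congr rfl fun j _ => ?_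
  rw [map_ofReal_pow, Matrix.map_apply, Complex.norm_real,
    Real.norm_of_nonneg (pow_apply_nonneg hM n i j)]

end NonnegMatrix

namespace UnaryWeightedAutomaton

/-! ### Traces of paths -/

/-- `W.HasTrace t u n S`: some path of length `n` from `u` to `t` visits exactly the strongly
connected components in `S`. The target is a parameter, so that induction follows the path from its
target backwards. -/
inductive HasTrace {Q : Type*} (W : UnaryWeightedAutomaton Q) (t : Q) :
    Q → ℕ → Set (Set Q) → Prop
  | nil : HasTrace W t t 0 {W.scc t}
  | cons {u y : Q} {n : ℕ} {S : Set (Set Q)} (h : 0 < W.A u y) (hy : HasTrace W t y n S) :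
      HasTrace W t u (n + 1) (insert (W.scc u) S)

variable {Q : Type*} {W : UnaryWeightedAutomaton Q}

theorem HasTrace.exists_isPath {t u : Q} {n : ℕ} {S : Set (Set Q)} (h : W.HasTrace t u n S) :
    ∃ p : Fin (n + 1) → Q, W.IsPath u t n p ∧ W.visited p = S := by
  induction h with
  | nil => exact ⟨fun _ => t, ⟨rfl, rfl, fun i => i.elim0⟩, by simp [visited]⟩
  | @cons u y n S h hy ih =>
    obtain ⟨p, ⟨hp0, hpn, hp⟩, rfl⟩ := ih
    refine ⟨Fin.cons u p, ⟨rfl, ?_, ?_⟩, ?_⟩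
    · rw [← Fin.succ_last, Fin.cons_succ, hpn]
    · intro i
      cases i using Fin.cases with
      | zero => simpa [hp0] using h
      | succ i =>
        rw [← Fin.succ_castSucc, Fin.cons_succ, Fin.cons_succ]
        exact hp i
    · ext φ
      simp [visited, Fin.exists_fin_succ, eq_comm]

theorem IsPath.hasTrace {t u : Q} {n : ℕ} {p : Fin (n + 1) → Q} (h : W.IsPath u t n p) :
    W.HasTrace t u n (W.visited p) := by
  induction n generalizing u with
  | zero =>
    obtain ⟨h0, hn, -⟩ := h
    have hu : t = u := hn.symm.trans h0
    subst hu
    have hv : W.visited p = {W.scc t} := by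
      ext φ
      simp [visited, Fin.exists_fin_succ, h0, eq_comm]
    rw [hv]
    exact .nil
  | succ n ih =>
    obtain ⟨h0, hn, hp⟩ := h
    have ht : W.HasTrace t (p 1) n (W.visited (Fin.tail p)) :=
      ih ⟨rfl, hn, fun i => hp i.succ⟩
    have hv : W.visited p = insert (W.scc u) (W.visited (Fin.tail p)) := by
      ext φ
      simp [visited, Fin.exists_fin_succ, h0, eq_comm, Fin.tail]
    rw [hv]
    exact .cons (by simpa [h0] using hp 0) ht

theorem HasTrace.scc_mem {t u : Q} {n : ℕ} {S : Set (Set Q)} (h : W.HasTrace t u n S) :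
    W.scc u ∈ S := by
  cases h with
  | nil => rfl
  | cons => exact Set.mem_insert _ _

variable [Fintype Q] [DecidableEq Q]

theorem HasTrace.pow_pos {t u : Q} {n : ℕ} {S : Set (Set Q)} (h : W.HasTrace t u n S) :
    0 < (W.A ^ n) u t := by
  induction h with
  | nil => simp
  | @cons u y n S h hy ih =>
    refine (mul_pos h ih).trans_le ?_
    rw [add_comm n 1]
    simpa using Matrix.pow_apply_mul_le W.nonneg 1 n u y t

theorem exists_edge_of_pow_succ_pos {t u : Q} {n : ℕ} (h : 0 < (W.A ^ (n + 1)) u t) :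
    ∃ y, 0 < W.A u y ∧ 0 < (W.A ^ n) y t := by
  rw [pow_succ', Matrix.mul_apply] at h
  obtain ⟨y, -, hy⟩ := Finset.exists_lt_of_sum_lt (s := Finset.univ) (f := fun _ => (0 : ℝ))
    (by simpa using h)
  exact ⟨y, pos_of_mul_pos_left hy (Matrix.pow_apply_nonneg W.nonneg n y t),
    pos_of_mul_pos_right hy (W.nonneg u y)⟩

theorem exists_hasTrace {t u : Q} {n : ℕ} (h : 0 < (W.A ^ n) u t) : ∃ S, W.HasTrace t u n S := by
  induction n generalizing u with
  | zero =>
    have : u = t := by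
      by_contra hne
      simp [Matrix.one_apply_ne hne] at h
    subst this
    exact ⟨_, .nil⟩
  | succ n ih =>
    obtain ⟨y, hy, hyt⟩ := exists_edge_of_pow_succ_pos h
    obtain ⟨S, hS⟩ := ih hyt
    exact ⟨_, .cons hy hS⟩

theorem exists_isPath_iff {t u : Q} {n : ℕ} : (∃ p, W.IsPath u t n p) ↔ 0 < (W.A ^ n) u t := by
  constructor
  · rintro ⟨p, hp⟩
    exact hp.hasTrace.pow_pos
  · intro h
    obtain ⟨S, hS⟩ := exists_hasTrace h
    obtain ⟨p, hp, -⟩ := hS.exists_isPath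
    exact ⟨p, hp⟩

theorem reaches_iff {u v : Q} : W.Reaches u v ↔ ∃ n, 0 < (W.A ^ n) u v :=
  exists_congr fun _ => exists_isPath_iff

theorem pow_pos_trans {u v w : Q} {m n : ℕ} (h : 0 < (W.A ^ m) u v) (h' : 0 < (W.A ^ n) v w) :
    0 < (W.A ^ (m + n)) u w :=
  (mul_pos h h').trans_le (Matrix.pow_apply_mul_le W.nonneg m n u v w)


theorem Reaches.trans {u v w : Q} (h : W.Reaches u v) (h' : W.Reaches v w) : W.Reaches u w := by
  obtain ⟨m, hm⟩ := reaches_iff.1 h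
  obtain ⟨n, hn⟩ := reaches_iff.1 h'
  exact reaches_iff.2 ⟨_, pow_pos_trans hm hn⟩

theorem Reaches.refl (u : Q) : W.Reaches u u := reaches_iff.2 ⟨0, by simp⟩

theorem Reaches.of_edge {u v : Q} (h : 0 < W.A u v) : W.Reaches u v :=
  reaches_iff.2 ⟨1, by simpa using h⟩

theorem mem_scc_self (u : Q) : u ∈ W.scc u := ⟨.refl u, .refl u⟩

theorem scc_eq_of_mem {u v : Q} (h : v ∈ W.scc u) : W.scc v = W.scc u := by
  ext w
  exact ⟨fun hw => ⟨h.1.trans hw.1, hw.2.trans h.2⟩, fun hw => ⟨h.2.trans hw.1, hw.2.trans h.1⟩⟩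

theorem mem_scc_of_scc_eq {u v : Q} (h : W.scc v = W.scc u) : v ∈ W.scc u := h ▸ mem_scc_self v

theorem HasTrace.exists_mem {t u : Q} {n : ℕ} {S : Set (Set Q)} (h : W.HasTrace t u n S)
    {φ : Set Q} (hφ : φ ∈ S) : ∃ v, W.Reaches u v ∧ φ = W.scc v := by
  induction h with
  | nil => exact ⟨t, .refl t, hφ⟩
  | @cons u y n S h hy ih =>
    rcases hφ with rfl | hφ
    · exact ⟨u, .refl u, rfl⟩
    · obtain ⟨v, hv, rfl⟩ := ih hφ
      exact ⟨v, (Reaches.of_edge h).trans hv, rfl⟩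

/-- A component which has been left is not visited again. -/
theorem HasTrace.scc_notMem {t u y : Q} {n : ℕ} {S : Set (Set Q)} (hy : W.HasTrace t y n S)
    (hu : ¬ W.Reaches y u) : W.scc u ∉ S := by
  intro hmem
  obtain ⟨v, hv, hvu⟩ := hy.exists_mem hmem
  exact hu (hv.trans (mem_scc_of_scc_eq hvu).1)

theorem HasTrace.exists_prepend {t u x : Q} {m n : ℕ} {S : Set (Set Q)} (hx : W.HasTrace t x n S)
    (hux : 0 < (W.A ^ m) u x) : ∃ S', W.HasTrace t u (m + n) S' ∧ S ⊆ S' := by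
  induction m generalizing u with
  | zero =>
    have : u = x := by
      by_contra hne
      simp [Matrix.one_apply_ne hne] at hux
    subst this
    exact ⟨S, by simpa using hx, subset_rfl⟩
  | succ m ih =>
    obtain ⟨y, hy, hyx⟩ := exists_edge_of_pow_succ_pos hux
    obtain ⟨S', hS', hSS'⟩ := ih hyx
    refine ⟨insert (W.scc u) S', ?_, hSS'.trans (Set.subset_insert _ _)⟩
    rw [Nat.add_right_comm]
    exact .cons hy hS'

end UnaryWeightedAutomaton

namespace UnaryWeightedAutomaton

/-! ### Growth inside a strongly connected component -/

variable {Q : Type*} [Fintype Q] {W : UnaryWeightedAutomaton Q}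

theorem radius_nonneg (W : UnaryWeightedAutomaton Q) (φ : Set Q) : 0 ≤ W.radius φ :=
  ENNReal.toReal_nonneg

variable [DecidableEq Q]

/-- A path between two states of a component does not leave it. -/
theorem submatrix_scc_pow_apply (q : Q) [Fintype (W.scc q)] [DecidableEq (W.scc q)] (n : ℕ)
    (a b : W.scc q) :
    (W.A.submatrix (fun q : W.scc q => (q : Q)) (fun q : W.scc q => (q : Q)) ^ n) a b =
      (W.A ^ n) a b := by
  classical
  induction n generalizing a with
  | zero => simp [Matrix.one_apply, Subtype.ext_iff]
  | succ n ih =>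
    rw [pow_succ', pow_succ', Matrix.mul_apply, Matrix.mul_apply]
    simp only [ih, Matrix.submatrix_apply]
    rw [← Finset.sum_subtype (Finset.univ.filter (· ∈ W.scc q)) (by simp)
      (fun x => W.A a x * (W.A ^ n) x b)]
    refine Finset.sum_filter_of_ne fun x _ hx => ?_
    have h1 : 0 < W.A a x := (W.nonneg _ _).lt_of_ne fun h => hx (by rw [← h, zero_mul])
    have h2 : 0 < (W.A ^ n) x b :=
      (Matrix.pow_apply_nonneg W.nonneg _ _ _).lt_of_ne fun h => hx (by rw [← h, mul_zero])
    exact ⟨a.2.1.trans (.of_edge h1), (reaches_iff.2 ⟨n, h2⟩).trans b.2.2⟩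

theorem pow_apply_self_le_radius_pow (a : Q) (n : ℕ) :
    (W.A ^ n) a a ≤ W.radius (W.scc a) ^ n := by
  classical
  have h := submatrix_scc_pow_apply a n ⟨a, mem_scc_self (W := W) a⟩ ⟨a, mem_scc_self a⟩
  rw [radius, ← h]
  convert! Matrix.pow_apply_self_le_spectralRadius_pow
    (M := W.A.submatrix (fun q : W.scc a => (q : Q)) (fun q : W.scc a => (q : Q)))
    (fun i j => W.nonneg i j) n _

theorem exists_radius_pow_le (a : Q) (n : ℕ) :
    ∃ c ∈ W.scc a, ∃ d ∈ W.scc a,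
      W.radius (W.scc a) ^ n ≤ (Fintype.card Q : ℝ) ^ 2 * (W.A ^ n) c d := by
  classical
  have : Nonempty (W.scc a) := ⟨⟨a, mem_scc_self a⟩⟩
  have h : W.radius (W.scc a) ^ n ≤ ∑ c : W.scc a, ∑ d : W.scc a, (W.A ^ n) c d := by
    simp only [← submatrix_scc_pow_apply]
    rw [radius]
    convert! Matrix.spectralRadius_pow_le_sum
      (M := W.A.submatrix (fun q : W.scc a => (q : Q)) (fun q : W.scc a => (q : Q)))
      (fun i j => W.nonneg i j) n
  by_contra! hlt
  set R := W.radius (W.scc a) ^ n with hR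
  have hQ : Nonempty Q := ⟨a⟩
  have hR0 : 0 ≤ R := pow_nonneg (radius_nonneg _ _) n
  have hcard : (Fintype.card (W.scc a) : ℝ) ≤ Fintype.card Q := by
    exact_mod_cast Fintype.card_le_of_injective _ Subtype.val_injective
  have hlt' : ∑ c : W.scc a, ∑ d : W.scc a, (Fintype.card Q : ℝ) ^ 2 * (W.A ^ n) c d <
      ∑ _c : W.scc a, ∑ _d : W.scc a, R :=
    Finset.sum_lt_sum_of_nonempty Finset.univ_nonempty fun c _ =>
      Finset.sum_lt_sum_of_nonempty Finset.univ_nonempty fun d _ => hlt c c.2 d d.2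
  simp only [← Finset.mul_sum, Finset.sum_const, Finset.card_univ, nsmul_eq_mul] at hlt'
  have h2 : (Fintype.card Q : ℝ) ^ 2 * R ≤ _ := mul_le_mul_of_nonneg_left h (by positivity)
  have h3 : (Fintype.card (W.scc a) : ℝ) * (Fintype.card (W.scc a) * R) ≤
      Fintype.card Q * (Fintype.card Q * R) := by gcongr
  linarith

theorem exists_pow_apply_le (a b : Q) (hb : b ∈ W.scc a) :
    ∃ C, 0 < C ∧ ∀ n, (W.A ^ n) a b ≤ C * W.radius (W.scc a) ^ n := by
  obtain ⟨m, hm⟩ := reaches_iff.1 hb.2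
  set r := W.radius (W.scc a) with hr
  have hr0 : 0 ≤ r := radius_nonneg _ _
  refine ⟨(r ^ m + 1) / (W.A ^ m) b a, by positivity, fun n => ?_⟩
  rw [div_mul_eq_mul_div, le_div_iff₀ hm]
  calc (W.A ^ n) a b * (W.A ^ m) b a ≤ (W.A ^ (n + m)) a a :=
        Matrix.pow_apply_mul_le W.nonneg n m a b a
    _ ≤ r ^ (n + m) := pow_apply_self_le_radius_pow a _
    _ = r ^ m * r ^ n := by ring
    _ ≤ (r ^ m + 1) * r ^ n := by gcongr; linarith

/-- In every window of bounded length, some return weight is as large as the spectral radius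
allows: some entry of the power is large, and it is completed to a closed path. -/
theorem exists_window (a : Q) : ∃ c, 0 < c ∧ ∃ L : ℕ, ∀ m, ∃ m', m ≤ m' ∧ m' ≤ m + L ∧
    c * W.radius (W.scc a) ^ m' ≤ (W.A ^ m') a a := by
  set r := W.radius (W.scc a) with hr
  have hr0 : 0 ≤ r := radius_nonneg _ _
  have h1 : ∀ c : W.scc a, ∃ l, 0 < (W.A ^ l) a c := fun c => reaches_iff.1 c.2.1
  have h2 : ∀ d : W.scc a, ∃ l, 0 < (W.A ^ l) d a := fun d => reaches_iff.1 d.2.2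
  choose l₁ hl₁ using h1
  choose l₂ hl₂ using h2
  have : Nonempty Q := ⟨a⟩
  have hN : 0 < (Fintype.card Q : ℝ) ^ 2 := by positivity
  obtain ⟨c, hc, hcle⟩ := Finite.exists_pos_le
    (fun x : W.scc a × W.scc a => (W.A ^ l₁ x.1) a x.1 * (W.A ^ l₂ x.2) x.2 a /
      ((Fintype.card Q : ℝ) ^ 2 * (r + 1) ^ (l₁ x.1 + l₂ x.2)))
    (fun x => div_pos (mul_pos (hl₁ _) (hl₂ _)) (by positivity))
  obtain ⟨L, hL⟩ := Finite.exists_le fun x : W.scc a × W.scc a => l₁ x.1 + l₂ x.2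
  refine ⟨c, hc, L, fun m => ?_⟩
  obtain ⟨x, hx, y, hy, hxy⟩ := exists_radius_pow_le (W := W) a m
  have hL' := hL (⟨x, hx⟩, ⟨y, hy⟩)
  have hc' := hcle (⟨x, hx⟩, ⟨y, hy⟩)
  have p1 := hl₁ ⟨x, hx⟩
  have p2 := hl₂ ⟨y, hy⟩
  dsimp only at hL' hc' p1 p2
  generalize l₁ ⟨x, hx⟩ = i at *
  generalize l₂ ⟨y, hy⟩ = j at *
  -- The closed path goes from `a` to `x`, then along the heavy entry to `y`, and back to `a`.
  refine ⟨i + m + j, by omega, by omega, ?_⟩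
  rw [le_div_iff₀ (by positivity)] at hc'
  have h3 : r ^ (i + j) ≤ (r + 1) ^ (i + j) := by gcongr; linarith
  rw [← hr] at hxy
  have h4 : c * r ^ (i + m + j) * (Fintype.card Q : ℝ) ^ 2 ≤
      (W.A ^ (i + m + j)) a a * (Fintype.card Q : ℝ) ^ 2 := by
    calc c * r ^ (i + m + j) * (Fintype.card Q : ℝ) ^ 2
        = c * ((Fintype.card Q : ℝ) ^ 2 * r ^ (i + j)) * r ^ m := by ring
      _ ≤ c * ((Fintype.card Q : ℝ) ^ 2 * (r + 1) ^ (i + j)) *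
          ((Fintype.card Q : ℝ) ^ 2 * (W.A ^ m) x y) := by gcongr
      _ ≤ ((W.A ^ i) a x * (W.A ^ j) y a) * ((Fintype.card Q : ℝ) ^ 2 * (W.A ^ m) x y) := by
          gcongr
          exact mul_nonneg hN.le (Matrix.pow_apply_nonneg W.nonneg m x y)
      _ = (W.A ^ i) a x * (W.A ^ m) x y * (W.A ^ j) y a * (Fintype.card Q : ℝ) ^ 2 := by ring
      _ ≤ _ := by
          gcongr
          exact (mul_le_mul_of_nonneg_right (Matrix.pow_apply_mul_le W.nonneg i m a x y)
            p2.le).trans (Matrix.pow_apply_mul_le W.nonneg _ j a y a)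
  exact le_of_mul_le_mul_right h4 hN

theorem exists_cycle_of_radius_pos {a : Q} (h : 0 < W.radius (W.scc a)) :
    ∃ m, 0 < m ∧ 0 < (W.A ^ m) a a := by
  obtain ⟨c, hc, L, hL⟩ := exists_window (W := W) a
  obtain ⟨m', hm, -, hle⟩ := hL 1
  exact ⟨m', by omega, (by positivity : 0 < c * W.radius (W.scc a) ^ m').trans_le hle⟩

theorem radius_pos_of_cycle {a : Q} {m : ℕ} (hm : 0 < m) (h : 0 < (W.A ^ m) a a) :
    0 < W.radius (W.scc a) := by
  refine (radius_nonneg _ _).lt_of_ne fun h0 => ?_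
  have := pow_apply_self_le_radius_pow (W := W) a m
  rw [← h0, zero_pow hm.ne'] at this
  exact absurd h this.not_gt

/-- If `P` is the length of a closed path at `a`, the return weights at the multiples of `P` are as
large as the spectral radius allows. The `P`-th power of a large return weight at time `m'` is a
large return weight at time `P * m'`, and such times are dense enough for closed paths of
length `P` to fill the gaps. -/
theorem exists_le_pow_mul_apply_self (a : Q) {P : ℕ} (hP : 0 < (W.A ^ P) a a) :
    ∃ c, 0 < c ∧ ∀ j, c * W.radius (W.scc a) ^ (P * j) ≤ (W.A ^ (P * j)) a a := by
  obtain ⟨c, hc, L, hL⟩ := exists_window (W := W) a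
  set r := W.radius (W.scc a) with hr
  have hr0 : 0 ≤ r := radius_nonneg _ _
  set w := (W.A ^ P) a a with hw
  obtain ⟨e, he, hele⟩ := Finite.exists_pos_le
    (fun i : Fin (L + 1) => w ^ (i : ℕ) / (r + 1) ^ (P * i)) (fun i => by positivity)
  have hfill : ∀ i ≤ L, e * r ^ (P * i) ≤ (W.A ^ (P * i)) a a := by
    intro i hi
    have h1 := hele ⟨i, by omega⟩
    rw [le_div_iff₀ (by positivity)] at h1
    have h2 : r ^ (P * i) ≤ (r + 1) ^ (P * i) := by gcongr; linarith
    calc e * r ^ (P * i) ≤ e * (r + 1) ^ (P * i) := by gcongr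
      _ ≤ w ^ i := h1
      _ ≤ _ := Matrix.pow_apply_self_pow_le W.nonneg P i a
  refine ⟨min (c ^ P * e) e, by positivity, fun j => ?_⟩
  rcases le_total j L with hj | hj
  · refine le_trans ?_ (hfill j hj)
    gcongr
    exact min_le_right _ _
  · -- The window ends at `j`, so that at most `L` closed paths of length `P` are missing.
    obtain ⟨m', h1, h2, h3⟩ := hL (j - L)
    obtain ⟨i, rfl⟩ : ∃ i, j = m' + i := ⟨j - m', by omega⟩
    have h4 : (c * r ^ m') ^ P ≤ (W.A ^ (P * m')) a a := by
      rw [mul_comm P m']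
      exact (pow_le_pow_left₀ (by positivity) h3 P).trans
        (Matrix.pow_apply_self_pow_le W.nonneg m' P a)
    calc min (c ^ P * e) e * r ^ (P * (m' + i)) ≤ (c ^ P * e) * r ^ (P * (m' + i)) := by
          gcongr
          exact min_le_left _ _
      _ = (c * r ^ m') ^ P * (e * r ^ (P * i)) := by ring
      _ ≤ (W.A ^ (P * m')) a a * (W.A ^ (P * i)) a a := by
          gcongr
          · exact Matrix.pow_apply_nonneg W.nonneg _ a a
          · exact hfill i (by omega)
      _ ≤ _ := by
          rw [Nat.mul_add]
          exact Matrix.pow_apply_mul_le W.nonneg _ _ a a a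

/-- A component of positive spectral radius contains a closed path; `P` is the product of the
lengths of such paths, one for each state. -/
theorem exists_common_period (W : UnaryWeightedAutomaton Q) :
    ∃ P, 0 < P ∧ ∀ a, 0 < W.radius (W.scc a) → 0 < (W.A ^ P) a a := by
  have h : ∀ a, ∃ m, 0 < m ∧ (0 < W.radius (W.scc a) → 0 < (W.A ^ m) a a) := by
    intro a
    by_cases hr : 0 < W.radius (W.scc a)
    · obtain ⟨m, hm, hm'⟩ := exists_cycle_of_radius_pos hr
      exact ⟨m, hm, fun _ => hm'⟩
    · exact ⟨1, one_pos, fun h => absurd h hr⟩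
  choose m hm hma using h
  refine ⟨∏ a, m a, Finset.prod_pos fun a _ => hm a, fun a ha => ?_⟩
  obtain ⟨k, hk⟩ := Finset.dvd_prod_of_mem m (Finset.mem_univ a)
  rw [hk]
  exact (pow_pos (hma a ha) k).trans_le (Matrix.pow_apply_self_pow_le W.nonneg _ k a)

end UnaryWeightedAutomaton

namespace UnaryWeightedAutomaton

/-! ### Lower bound -/

variable {Q : Type*} [Fintype Q] {W : UnaryWeightedAutomaton Q}

/-- The number of components of spectral radius `ρ` in `S`. -/
noncomputable def radiusCount (W : UnaryWeightedAutomaton Q) (ρ : ℝ) (S : Set (Set Q)) : ℕ :=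
  {φ ∈ S | W.radius φ = ρ}.ncard

theorem radiusCount_mono {ρ : ℝ} {S S' : Set (Set Q)} (h : S ⊆ S') :
    W.radiusCount ρ S ≤ W.radiusCount ρ S' :=
  Set.ncard_le_ncard (fun _ hφ => ⟨h hφ.1, hφ.2⟩) (Set.toFinite _)

theorem radiusCount_insert_of_ne {ρ : ℝ} {S : Set (Set Q)} {φ : Set Q} (h : W.radius φ ≠ ρ) :
    W.radiusCount ρ (insert φ S) = W.radiusCount ρ S := by
  unfold radiusCount
  congr 1
  ext ψ
  constructor
  · rintro ⟨rfl | h1, h2⟩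
    · exact absurd h2 h
    · exact ⟨h1, h2⟩
  · rintro ⟨h1, h2⟩
    exact ⟨.inr h1, h2⟩

theorem radiusCount_insert_of_eq {S : Set (Set Q)} {φ : Set Q} (hφ : φ ∉ S) :
    W.radiusCount (W.radius φ) (insert φ S) = W.radiusCount (W.radius φ) S + 1 := by
  unfold radiusCount
  rw [← Set.ncard_insert_of_notMem (a := φ) (fun h => hφ h.1) (Set.toFinite _)]
  congr 1
  ext ψ
  constructor
  · rintro ⟨rfl | h1, h2⟩
    · exact Set.mem_insert _ _
    · exact .inr ⟨h1, h2⟩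
  · rintro (rfl | ⟨h1, h2⟩)
    · exact ⟨Set.mem_insert _ _, rfl⟩
    · exact ⟨.inr h1, h2⟩

theorem radiusCount_pos {S : Set (Set Q)} {φ : Set Q} (hφ : φ ∈ S) :
    0 < W.radiusCount (W.radius φ) S :=
  (Set.ncard_pos (Set.toFinite _)).2 ⟨φ, hφ, rfl⟩

variable [DecidableEq Q]

/-- If `u` cannot be reached from `y`, a path takes the edge from `u` to `y` at most once, so that
the weights of the paths taking it at different times add up. -/
theorem sum_pow_mul_pow_le {u y : Q} (hy : ¬ W.Reaches y u) (t v : Q) (N : ℕ) :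
    ∑ i ∈ Finset.range (N + 1), (W.A ^ i) v u * W.A u y * (W.A ^ (N - i)) y t ≤
      (W.A ^ (N + 1)) v t := by
  have hyu : ∀ i, (W.A ^ i) y u = 0 := fun i => by
    by_contra h
    exact hy (reaches_iff.2 ⟨i, (Matrix.pow_apply_nonneg W.nonneg _ _ _).lt_of_ne' h⟩)
  induction N generalizing v with
  | zero =>
    simp only [zero_add, Finset.range_one, Finset.sum_singleton, pow_zero, pow_one, Nat.sub_self,
      Matrix.one_apply]
    split_ifs with h1 h2
    · subst h1 h2
      simp
    · simpa using W.nonneg v t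
    · simpa using W.nonneg v t
    · simpa using W.nonneg v t
  | succ N ih =>
    have hstep : ∑ i ∈ Finset.range (N + 1 + 1),
        (W.A ^ i) v u * W.A u y * (W.A ^ (N + 1 - i)) y t =
        ∑ w, W.A v w * ∑ i ∈ Finset.range (N + 1), (W.A ^ i) w u * W.A u y * (W.A ^ (N - i)) y t +
        (1 : Matrix Q Q ℝ) v u * W.A u y * (W.A ^ (N + 1)) y t := by
      rw [Finset.sum_range_succ']
      congr 1
      simp only [Finset.mul_sum]
      rw [Finset.sum_comm]
      refine Finset.sum_congr rfl fun i _ => ?_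
      rw [pow_succ', Matrix.mul_apply, Nat.add_sub_add_right, Finset.sum_mul, Finset.sum_mul]
      exact Finset.sum_congr rfl fun w _ => by ring
    rw [hstep, pow_succ' W.A (N + 1), Matrix.mul_apply]
    -- The summand `w = y` vanishes on the left, and leaves room for the paths from `u` that begin
    -- with the edge to `y`.
    have hle : ∀ w, W.A v w * ∑ i ∈ Finset.range (N + 1),
        (W.A ^ i) w u * W.A u y * (W.A ^ (N - i)) y t ≤ W.A v w * (W.A ^ (N + 1)) w t :=
      fun w => mul_le_mul_of_nonneg_left (ih w) (W.nonneg v w)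
    rw [← Finset.add_sum_erase _ _ (Finset.mem_univ y),
      ← Finset.add_sum_erase _ _ (Finset.mem_univ y)]
    have hsum := Finset.sum_le_sum (s := Finset.univ.erase y) fun w _ => hle w
    have hy0 : ∑ i ∈ Finset.range (N + 1), (W.A ^ i) y u * W.A u y * (W.A ^ (N - i)) y t = 0 :=
      Finset.sum_eq_zero fun i _ => by rw [hyu, zero_mul, zero_mul]
    rw [hy0, mul_zero, zero_add]
    have hone : (1 : Matrix Q Q ℝ) v u * W.A u y * (W.A ^ (N + 1)) y t ≤
        W.A v y * (W.A ^ (N + 1)) y t := by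
      rw [Matrix.one_apply]
      split_ifs with h
      · rw [h, one_mul]
      · rw [zero_mul, zero_mul]
        exact mul_nonneg (W.nonneg v y) (Matrix.pow_apply_nonneg W.nonneg _ _ _)
    linarith

/-- Pumping closed paths of length `P` in every component of spectral radius `ρ` visited. The
binomial coefficient counts the ways of distributing `j` closed paths over `K + 1` components. -/
theorem HasTrace.exists_choose_mul_le {ρ : ℝ} (hρ : 0 < ρ) {P : ℕ} (hP : 0 < P)
    (hPa : ∀ a, 0 < W.radius (W.scc a) → 0 < (W.A ^ P) a a) {t u : Q} {n : ℕ} {S : Set (Set Q)}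
    (h : W.HasTrace t u n S) (K : ℕ) (hK : W.radiusCount ρ S = K + 1) :
    ∃ c, 0 < c ∧ ∀ j, c * (ρ ^ (n + P * j) * (j + K).choose K) ≤ (W.A ^ (n + P * j)) u t := by
  induction h generalizing K with
  | nil =>
    have hr : W.radius (W.scc t) = ρ := by
      by_contra hne
      rw [← insert_empty_eq, radiusCount_insert_of_ne hne] at hK
      simp [radiusCount] at hK
    have hK0 : K = 0 := by
      rw [← insert_empty_eq, ← hr, radiusCount_insert_of_eq (by simp)] at hK
      simpa [radiusCount] using hK.symm
    subst hK0
    obtain ⟨c, hc, hle⟩ := exists_le_pow_mul_apply_self t (hPa t (hr ▸ hρ))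
    exact ⟨c, hc, fun j => by simpa [hr] using hle j⟩
  | @cons u y n S h hy ih =>
    by_cases hcase : W.radiusCount ρ S = K + 1
    · obtain ⟨c, hc, hle⟩ := ih K hcase
      refine ⟨W.A u y * c * ρ⁻¹, by positivity, fun j => ?_⟩
      have h1 := Matrix.pow_apply_mul_le W.nonneg 1 (n + P * j) u y t
      rw [pow_one, ← add_assoc, add_comm 1 n] at h1
      refine le_trans ?_ h1
      calc _ = W.A u y * (c * (ρ ^ (n + P * j) * (j + K).choose K)) := by
            rw [add_right_comm n 1, pow_succ]
            field_simp
        _ ≤ _ := mul_le_mul_of_nonneg_left (hle j) h.le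
    · -- The count has grown, so the component of `u` has radius `ρ` and is left by the first edge.
      have hr : W.radius (W.scc u) = ρ := by
        by_contra hne
        exact hcase (by rw [← hK, radiusCount_insert_of_ne hne])
      have hu : W.scc u ∉ S := fun hmem => hcase (by rw [← hK, Set.insert_eq_of_mem hmem])
      have hyu : ¬ W.Reaches y u := fun hyu => hu (by
        rw [← scc_eq_of_mem (u := u) (v := y) ⟨.of_edge h, hyu⟩]
        exact hy.scc_mem)
      have hKS : W.radiusCount ρ S = K := by
        rw [← hr, radiusCount_insert_of_eq hu, hr] at hK
        omega
      obtain ⟨c, hc, hle⟩ := exists_le_pow_mul_apply_self u (hPa u (hr ▸ hρ))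
      rw [hr] at hle
      cases K with
      | zero =>
        refine ⟨c * W.A u y * (W.A ^ n) y t * (ρ ^ (n + 1))⁻¹,
          by have := hy.pow_pos; positivity, fun j => ?_⟩
        have h1 := Matrix.pow_apply_mul_le W.nonneg 1 n u y t
        have h2 := Matrix.pow_apply_mul_le W.nonneg (P * j) (1 + n) u u t
        rw [pow_one] at h1
        rw [add_comm (n + 1), add_comm n 1]
        refine le_trans ?_ h2
        calc _ = c * ρ ^ (P * j) * (W.A u y * (W.A ^ n) y t) := by
              rw [pow_add, add_comm 1 n]
              simp only [add_zero, Nat.choose_zero_right, Nat.cast_one, mul_one]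
              field_simp
              ring
          _ ≤ _ := mul_le_mul (hle j) h1
              (mul_nonneg h.le (Matrix.pow_apply_nonneg W.nonneg _ _ _))
              (Matrix.pow_apply_nonneg W.nonneg _ _ _)
      | succ K =>
        obtain ⟨c', hc', hle'⟩ := ih K hKS
        refine ⟨c * W.A u y * c' * ρ⁻¹, by positivity, fun j => ?_⟩
        rw [add_right_comm n 1]
        refine le_trans ?_ (sum_pow_mul_pow_le hyu t u (n + P * j))
        -- Only the terms in which the first component takes a multiple of `P` steps are kept.
        have himg : (Finset.range (j + 1)).image (P * ·) ⊆ Finset.range (n + P * j + 1) := by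
          intro x hx
          obtain ⟨i, hi, rfl⟩ := Finset.mem_image.1 hx
          have : P * i ≤ P * j := Nat.mul_le_mul_left P (by simpa [Nat.lt_succ_iff] using hi)
          simp only [Finset.mem_range]
          omega
        refine le_trans ?_ (Finset.sum_le_sum_of_subset_of_nonneg himg fun i _ _ =>
          mul_nonneg (mul_nonneg (Matrix.pow_apply_nonneg W.nonneg _ _ _) h.le)
            (Matrix.pow_apply_nonneg W.nonneg _ _ _))
        rw [Finset.sum_image fun a _ b _ hab => Nat.eq_of_mul_eq_mul_left hP hab]
        have hterm : ∀ i ∈ Finset.range (j + 1),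
            c * W.A u y * c' * ρ ^ (n + P * j) * ((j - i + K).choose K : ℝ) ≤
            (W.A ^ (P * i)) u u * W.A u y * (W.A ^ (n + P * j - P * i)) y t := by
          intro i hi
          obtain ⟨l, rfl⟩ : ∃ l, j = i + l :=
            ⟨j - i, by have := Finset.mem_range.1 hi; omega⟩
          rw [Nat.add_sub_cancel_left, show n + P * (i + l) - P * i = n + P * l by
            rw [Nat.mul_add]; omega]
          calc _ = c * ρ ^ (P * i) * W.A u y * (c' * (ρ ^ (n + P * l) * (l + K).choose K)) := by
                ring
            _ ≤ _ := by
                have := hle i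
                have := hle' l
                have := Matrix.pow_apply_nonneg W.nonneg (P * i) u u
                gcongr
        refine le_trans (le_of_eq ?_) (Finset.sum_le_sum hterm)
        have hcount : ∑ i ∈ Finset.range (j + 1), ((j - i + K).choose K : ℝ) =
            (j + (K + 1)).choose (K + 1) := by
          have h1 := Finset.sum_range_reflect (fun i => ((i + K).choose K : ℝ)) (j + 1)
          rw [Nat.add_sub_cancel] at h1
          rw [h1, ← add_assoc]
          exact_mod_cast Nat.sum_range_add_choose j K
        rw [← Finset.mul_sum, hcount, pow_succ]
        field_simp

/-- Among the paths with given end points and components and with length in a given residue class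
modulo the common period, the shortest is pumped to all the others' lengths. -/
theorem exists_lower_bound (W : UnaryWeightedAutomaton Q) (u t : Q) :
    ∃ c, 0 < c ∧ ∀ n S q K, W.HasTrace t u n S → 0 < W.radius (W.scc q) →
      W.radiusCount (W.radius (W.scc q)) S = K + 1 →
      c * (W.radius (W.scc q) ^ n * (n : ℝ) ^ K) ≤ (W.A ^ n) u t := by
  classical
  obtain ⟨P, hP, hPa⟩ := exists_common_period W
  have key : ∀ x : Set (Set Q) × Fin P × Q, ∃ c, 0 < c ∧ ∀ n K, n % P = x.2.1 →
      W.HasTrace t u n x.1 → 0 < W.radius (W.scc x.2.2) →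
      W.radiusCount (W.radius (W.scc x.2.2)) x.1 = K + 1 →
      c * (W.radius (W.scc x.2.2) ^ n * (n : ℝ) ^ K) ≤ (W.A ^ n) u t := by
    rintro ⟨S, r, q⟩
    set ρ := W.radius (W.scc q) with hρdef
    by_cases hex : ∃ n, n % P = r ∧ W.HasTrace t u n S
    swap
    · exact ⟨1, one_pos, fun n K h1 h2 => absurd ⟨n, h1, h2⟩ hex⟩
    by_cases hρ : 0 < ρ
    swap
    · exact ⟨1, one_pos, fun n K _ _ h => absurd h hρ⟩
    by_cases hK : ∃ K, W.radiusCount ρ S = K + 1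
    swap
    · exact ⟨1, one_pos, fun n K _ _ _ h => absurd ⟨K, h⟩ hK⟩
    obtain ⟨K, hK⟩ := hK
    obtain ⟨hr, htr⟩ := Nat.find_spec hex
    have hmin : ∀ n, n % P = r → W.HasTrace t u n S → Nat.find hex ≤ n :=
      fun n h1 h2 => Nat.find_min' hex ⟨h1, h2⟩
    generalize Nat.find hex = n₀ at hr htr hmin
    obtain ⟨c, hc, hle⟩ := htr.exists_choose_mul_le hρ hP hPa K hK
    refine ⟨c / ((n₀ + P) ^ K * K.factorial), by positivity, fun n K' h1 h2 _ h3 => ?_⟩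
    obtain rfl : K' = K := Nat.succ_injective (h3.symm.trans hK)
    obtain ⟨j, rfl⟩ : ∃ j, n = n₀ + P * j := by
      obtain ⟨j, hj⟩ := (Nat.modEq_iff_dvd' (hmin n h1 h2)).1 (hr.trans h1.symm : n₀ ≡ n [MOD P])
      exact ⟨j, by have := hmin n h1 h2; omega⟩
    refine le_trans ?_ (hle j)
    rw [div_mul_eq_mul_div, div_le_iff₀ (by positivity)]
    have h4 : ((n₀ + P * j : ℕ) : ℝ) ≤ (n₀ + P) * (j + 1) := by
      push_cast
      have : (0 : ℝ) ≤ n₀ * j + P := by positivity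
      linarith
    have h5 : ((j : ℝ) + 1) ^ K' ≤ K'.factorial * (j + K').choose K' := by
      have := Nat.pow_succ_le_ascFactorial (j + 1) K'
      rw [Nat.ascFactorial_eq_factorial_mul_choose] at this
      exact_mod_cast this
    calc c * (ρ ^ (n₀ + P * j) * ((n₀ + P * j : ℕ) : ℝ) ^ K')
        ≤ c * (ρ ^ (n₀ + P * j) * ((n₀ + P) * (j + 1)) ^ K') := by gcongr
      _ = c * (ρ ^ (n₀ + P * j) * ((n₀ + P) ^ K' * (j + 1) ^ K')) := by rw [mul_pow]
      _ ≤ c * (ρ ^ (n₀ + P * j) * ((n₀ + P) ^ K' *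
          (K'.factorial * (j + K').choose K'))) := by gcongr
      _ = _ := by ring
  choose c hc hle using key
  obtain ⟨c₀, hc₀, hc₀le⟩ := Finite.exists_pos_le c hc
  refine ⟨c₀, hc₀, fun n S q K h hq hK => ?_⟩
  refine le_trans ?_ (hle (S, ⟨n % P, Nat.mod_lt n hP⟩, q) n K rfl h hq hK)
  exact mul_le_mul_of_nonneg_right (hc₀le _) (by positivity)

end UnaryWeightedAutomaton

namespace UnaryWeightedAutomaton

/-! ### Upper bound -/

variable {Q : Type*} {W : UnaryWeightedAutomaton Q}

open Classical in
/-- The transitions that leave the set of states `φ`. -/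
noncomputable def exitMatrix (W : UnaryWeightedAutomaton Q) (φ : Set Q) : Matrix Q Q ℝ :=
  .of fun x y => if x ∈ φ ∧ y ∉ φ then W.A x y else 0

theorem exitMatrix_nonneg (W : UnaryWeightedAutomaton Q) (φ : Set Q) (x y : Q) :
    0 ≤ W.exitMatrix φ x y := by
  simp only [exitMatrix, Matrix.of_apply]
  split_ifs
  exacts [W.nonneg x y, le_rfl]

theorem of_exitMatrix_pos {φ : Set Q} {x y : Q} (h : 0 < W.exitMatrix φ x y) :
    x ∈ φ ∧ y ∉ φ ∧ 0 < W.A x y := by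
  simp only [exitMatrix, Matrix.of_apply] at h
  split_ifs at h with hxy
  · exact ⟨hxy.1, hxy.2, h⟩
  · exact absurd h (lt_irrefl 0)

variable [Fintype Q] [DecidableEq Q]

/-- The growth, relative to `ρ ^ n`, of the weight of paths which visit at most `K` components of
spectral radius `ρ` and none of larger spectral radius. The case `K = 0`, where the growth is
exponentially slower than `ρ ^ n`, lets an induction on the components run uniformly. -/
noncomputable def relativeGrowth (θ : ℝ) : ℕ → ℕ → ℝ
  | 0, n => θ ^ n
  | K + 1, n => ((n : ℝ) + 1) ^ K

theorem relativeGrowth_pos {θ : ℝ} (hθ : 0 < θ) (K n : ℕ) : 0 < relativeGrowth θ K n := by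
  cases K <;> simp only [relativeGrowth] <;> positivity

theorem pow_le_relativeGrowth {θ : ℝ} (hθ : 0 < θ) (hθ1 : θ < 1) (K n : ℕ) :
    θ ^ n ≤ relativeGrowth θ K n := by
  cases K with
  | zero => exact le_rfl
  | succ K => exact (pow_le_one₀ hθ.le hθ1.le).trans (one_le_pow₀ (by simp))

theorem sum_pow_mul_pow_le_div {x y : ℝ} (hx : 0 ≤ x) (hxy : x < y) (n : ℕ) :
    ∑ m ∈ Finset.range n, x ^ m * y ^ (n - 1 - m) ≤ 1 / (y - x) * y ^ n := by
  have h := (Commute.all x y).geom_sum₂_mul n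
  rw [one_div, inv_mul_eq_div, le_div_iff₀ (sub_pos.2 hxy)]
  have : 0 ≤ x ^ n := pow_nonneg hx n
  linarith

theorem sum_pow_mul_relativeGrowth_le {θ x : ℝ} (hθ1 : θ < 1) (hx : 0 ≤ x) (hxθ : x < θ)
    (K n : ℕ) :
    ∑ m ∈ Finset.range n, x ^ m * relativeGrowth θ K (n - 1 - m) ≤
      1 / (θ - x) * relativeGrowth θ K n := by
  cases K with
  | zero => exact sum_pow_mul_pow_le_div hx hxθ n
  | succ K =>
    have h1 : ∀ m ∈ Finset.range n, x ^ m * relativeGrowth θ (K + 1) (n - 1 - m) ≤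
        x ^ m * 1 ^ (n - 1 - m) * ((n : ℝ) + 1) ^ K := by
      intro m _
      rw [one_pow, mul_one]
      have : ((n - 1 - m : ℕ) : ℝ) ≤ n := by exact_mod_cast (by omega : n - 1 - m ≤ n)
      simp only [relativeGrowth]
      gcongr
    refine (Finset.sum_le_sum h1).trans ?_
    rw [← Finset.sum_mul]
    simp only [relativeGrowth]
    gcongr
    refine (sum_pow_mul_pow_le_div hx (hxθ.trans hθ1) n).trans ?_
    rw [one_pow, mul_one]
    exact one_div_le_one_div_of_le (by linarith) (by linarith)

theorem sum_relativeGrowth_le {θ : ℝ} (hθ : 0 < θ) (hθ1 : θ < 1) (K n : ℕ) :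
    ∑ m ∈ Finset.range n, relativeGrowth θ K (n - 1 - m) ≤
      1 / (1 - θ) * relativeGrowth θ (K + 1) n := by
  rw [Finset.sum_range_reflect (fun m => relativeGrowth θ K m)]
  cases K with
  | zero =>
    have := sum_pow_mul_pow_le_div hθ.le hθ1 n
    simpa [relativeGrowth] using this
  | succ K =>
    have h1 : ∀ m ∈ Finset.range n, relativeGrowth θ (K + 1) m ≤ ((n : ℝ) + 1) ^ K := by
      intro m hm
      have : (m : ℝ) ≤ n := by exact_mod_cast (Finset.mem_range.1 hm).le
      simp only [relativeGrowth]
      gcongr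
    have h2 : (1 : ℝ) ≤ 1 / (1 - θ) := by
      rw [le_div_iff₀ (by linarith)]
      linarith
    calc _ ≤ ∑ _m ∈ Finset.range n, ((n : ℝ) + 1) ^ K := Finset.sum_le_sum h1
      _ = n * ((n : ℝ) + 1) ^ K := by simp
      _ ≤ (n + 1) * ((n : ℝ) + 1) ^ K := by gcongr; linarith
      _ = 1 * ((n : ℝ) + 1) ^ (K + 1) := by ring
      _ ≤ _ := by
        simp only [relativeGrowth]
        gcongr

/-- A path from a state of `φ` to a state outside of `φ` leaves `φ` for a first time. -/
theorem pow_apply_le_sum_exitMatrix {φ : Set Q} {v t : Q} (hv : v ∈ φ) (ht : t ∉ φ) (n : ℕ) :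
    (W.A ^ n) v t ≤
      ∑ m ∈ Finset.range n, (W.A ^ m * W.exitMatrix φ * W.A ^ (n - 1 - m)) v t := by
  induction n generalizing v with
  | zero =>
    have : v ≠ t := fun h => ht (h ▸ hv)
    simp [this]
  | succ n ih =>
    rw [Finset.sum_range_succ']
    have hshift : ∀ m, W.A ^ (m + 1) * W.exitMatrix φ * W.A ^ (n + 1 - 1 - (m + 1)) =
        W.A * (W.A ^ m * W.exitMatrix φ * W.A ^ (n - 1 - m)) := fun m => by
      rw [show n + 1 - 1 - (m + 1) = n - 1 - m by omega, pow_succ']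
      simp only [Matrix.mul_assoc]
    simp only [hshift, pow_zero, one_mul]
    simp only [Nat.add_sub_cancel, Nat.sub_zero, Matrix.mul_apply (M := W.A),
      Matrix.mul_apply (M := W.exitMatrix φ), pow_succ' W.A n]
    rw [Finset.sum_comm, ← Finset.sum_add_distrib]
    refine Finset.sum_le_sum fun w _ => ?_
    rw [← Finset.mul_sum]
    have hsum : 0 ≤ ∑ m ∈ Finset.range n,
        (W.A ^ m * W.exitMatrix φ * W.A ^ (n - 1 - m)) w t := by
      refine Finset.sum_nonneg fun m _ => ?_
      rw [Matrix.mul_apply]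
      refine Finset.sum_nonneg fun y _ => mul_nonneg ?_ (Matrix.pow_apply_nonneg W.nonneg _ _ _)
      rw [Matrix.mul_apply]
      exact Finset.sum_nonneg fun x _ =>
        mul_nonneg (Matrix.pow_apply_nonneg W.nonneg _ _ _) (exitMatrix_nonneg _ _ _ _)
    by_cases hw : w ∈ φ
    · refine (mul_le_mul_of_nonneg_left (ih hw) (W.nonneg v w)).trans ?_
      exact le_add_of_nonneg_right
        (mul_nonneg (exitMatrix_nonneg _ _ _ _) (Matrix.pow_apply_nonneg W.nonneg _ _ _))
    · have : W.exitMatrix φ v w = W.A v w := by simp [exitMatrix, hv, hw]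
      rw [this]
      exact le_add_of_nonneg_left (mul_nonneg (W.nonneg v w) hsum)

/-- One step of the upper bound: the paths stay in the component of `u`, whose contribution is
convolved with the bound `K'` for the states entered next. -/
theorem exists_upper_bound_step {ρ θ : ℝ} (hρ : 0 < ρ) (hθ : 0 < θ) {u t : Q}
    (ht : t ∉ W.scc u) {K K' : ℕ} {D : ℝ} (hD : 0 < D)
    (hconv : ∀ n, ∑ m ∈ Finset.range n,
      (W.radius (W.scc u) / ρ) ^ m * relativeGrowth θ K' (n - 1 - m) ≤ D * relativeGrowth θ K n)
    (hcount : ∀ S, W.scc u ∉ S → W.radiusCount ρ (insert (W.scc u) S) ≤ K →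
      W.radiusCount ρ S ≤ K')
    (ih : ∀ y, W.Reaches u y → ¬ W.Reaches y u → ∃ C, 0 < C ∧ ∀ n,
      (∀ S, W.HasTrace t y n S → (∀ φ ∈ S, W.radius φ ≤ ρ) ∧ W.radiusCount ρ S ≤ K') →
      (W.A ^ n) y t ≤ C * (ρ ^ n * relativeGrowth θ K' n)) :
    ∃ C, 0 < C ∧ ∀ n,
      (∀ S, W.HasTrace t u n S → (∀ φ ∈ S, W.radius φ ≤ ρ) ∧ W.radiusCount ρ S ≤ K) →
      (W.A ^ n) u t ≤ C * (ρ ^ n * relativeGrowth θ K n) := by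
  set r := W.radius (W.scc u) with hr
  have hr0 : 0 ≤ r := radius_nonneg _ _
  obtain ⟨C₁, hC₁, hC₁le⟩ : ∃ C, 0 < C ∧ ∀ x ∈ W.scc u, ∀ n, (W.A ^ n) u x ≤ C * r ^ n := by
    choose f hf hfle using fun x : W.scc u => exists_pow_apply_le (W := W) u x x.2
    obtain ⟨C, hC, hle⟩ := Finite.exists_pos_ge f
    exact ⟨C, hC, fun x hx n => (hfle ⟨x, hx⟩ n).trans
      (mul_le_mul_of_nonneg_right (hle _) (pow_nonneg hr0 n))⟩
  obtain ⟨C₂, hC₂, hC₂le⟩ : ∃ C, 0 < C ∧ ∀ y, W.Reaches u y → ¬ W.Reaches y u → ∀ n,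
      (∀ S, W.HasTrace t y n S → (∀ φ ∈ S, W.radius φ ≤ ρ) ∧ W.radiusCount ρ S ≤ K') →
      (W.A ^ n) y t ≤ C * (ρ ^ n * relativeGrowth θ K' n) := by
    choose f hf hfle using
      fun y : {y // W.Reaches u y ∧ ¬ W.Reaches y u} => ih y y.2.1 y.2.2
    obtain ⟨C, hC, hle⟩ := Finite.exists_pos_ge f
    refine ⟨C, hC, fun y h1 h2 n hn => (hfle ⟨y, h1, h2⟩ n hn).trans ?_⟩
    have := relativeGrowth_pos hθ K' n
    exact mul_le_mul_of_nonneg_right (hle _) (by positivity)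
  set a := ∑ y, ∑ x, W.A x y with ha
  have ha0 : 0 ≤ a := Finset.sum_nonneg fun y _ => Finset.sum_nonneg fun x _ => W.nonneg x y
  refine ⟨C₁ * C₂ * (a + 1) * ρ⁻¹ * D, by positivity, fun n hn => ?_⟩
  refine (pow_apply_le_sum_exitMatrix (mem_scc_self u) ht n).trans ?_
  have hterm : ∀ m ∈ Finset.range n,
      (W.A ^ m * W.exitMatrix (W.scc u) * W.A ^ (n - 1 - m)) u t ≤
      C₁ * C₂ * (a + 1) * ρ⁻¹ * ρ ^ n * ((r / ρ) ^ m * relativeGrowth θ K' (n - 1 - m)) := by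
    intro m hm
    obtain ⟨l, rfl⟩ : ∃ l, n = m + 1 + l :=
      ⟨n - (m + 1), by have := Finset.mem_range.1 hm; omega⟩
    rw [show m + 1 + l - 1 - m = l by omega]
    have hg := relativeGrowth_pos hθ K' l
    have hxy : ∀ x y, (W.A ^ m) u x * W.exitMatrix (W.scc u) x y * (W.A ^ l) y t ≤
        W.A x y * (C₁ * r ^ m * (C₂ * (ρ ^ l * relativeGrowth θ K' l))) := by
      intro x y
      have hA0 := W.nonneg x y
      have h1 := Matrix.pow_apply_nonneg W.nonneg m u x
      have h2 := exitMatrix_nonneg W (W.scc u) x y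
      have h3 := Matrix.pow_apply_nonneg W.nonneg l y t
      by_cases hpos : 0 < (W.A ^ m) u x * W.exitMatrix (W.scc u) x y * (W.A ^ l) y t
      swap
      · exact (not_lt.1 hpos).trans (by positivity)
      have h12 := pos_of_mul_pos_left hpos h3
      have p3 := pos_of_mul_pos_right hpos (mul_nonneg h1 h2)
      have p1 := pos_of_mul_pos_left h12 h2
      obtain ⟨hx, hy, hA⟩ := of_exitMatrix_pos (pos_of_mul_pos_right h12 h1)
      have hE : W.exitMatrix (W.scc u) x y = W.A x y := by simp [exitMatrix, hx, hy]
      have huy : W.Reaches u y := hx.1.trans (.of_edge hA)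
      have hyu : ¬ W.Reaches y u := fun h => hy ⟨huy, h⟩
      have hbound := hC₂le y huy hyu l fun S hS => by
        obtain ⟨S', hS', hSS'⟩ := (HasTrace.cons hA hS).exists_prepend p1
        rw [show m + (l + 1) = m + 1 + l by omega] at hS'
        have hsub : S ⊆ S' := (Set.subset_insert _ _).trans hSS'
        refine ⟨fun φ hφ => (hn S' hS').1 φ (hsub hφ), hcount S (hS.scc_notMem hyu) ?_⟩
        exact (radiusCount_mono (Set.insert_subset hS'.scc_mem hsub)).trans (hn S' hS').2
      rw [hE]
      have hC := hC₁le x hx m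
      calc (W.A ^ m) u x * W.A x y * (W.A ^ l) y t
          ≤ C₁ * r ^ m * W.A x y * (C₂ * (ρ ^ l * relativeGrowth θ K' l)) := by gcongr
        _ = _ := by ring
    calc (W.A ^ m * W.exitMatrix (W.scc u) * W.A ^ l) u t
        = ∑ y, ∑ x, (W.A ^ m) u x * W.exitMatrix (W.scc u) x y * (W.A ^ l) y t := by
          simp only [Matrix.mul_apply, Finset.sum_mul]
      _ ≤ ∑ y, ∑ x, W.A x y * (C₁ * r ^ m * (C₂ * (ρ ^ l * relativeGrowth θ K' l))) :=
          Finset.sum_le_sum fun y _ => Finset.sum_le_sum fun x _ => hxy x y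
      _ = a * (C₁ * r ^ m * (C₂ * (ρ ^ l * relativeGrowth θ K' l))) := by
          simp only [ha, Finset.sum_mul]
      _ ≤ (a + 1) * (C₁ * r ^ m * (C₂ * (ρ ^ l * relativeGrowth θ K' l))) := by
          gcongr
          linarith
      _ = _ := by
          rw [div_pow, pow_add, pow_add]
          field_simp
  calc _ ≤ _ := Finset.sum_le_sum hterm
    _ = C₁ * C₂ * (a + 1) * ρ⁻¹ * ρ ^ n * ∑ m ∈ Finset.range n,
        (r / ρ) ^ m * relativeGrowth θ K' (n - 1 - m) := by rw [Finset.mul_sum]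
    _ ≤ C₁ * C₂ * (a + 1) * ρ⁻¹ * ρ ^ n * (D * relativeGrowth θ K n) := by
        gcongr
        exact hconv n
    _ = _ := by ring

/-- The bound by the relative growth, for those lengths `n` at which the paths meet the constraints
given by `ρ` and `K`. The constant does not depend on `n`. -/
theorem exists_upper_bound_relativeGrowth {ρ θ : ℝ} (hρ : 0 < ρ) (hθ : 0 < θ) (hθ1 : θ < 1)
    (hsep : ∀ q, W.radius (W.scc q) < ρ → W.radius (W.scc q) < θ * ρ) (t u : Q) (K : ℕ) :
    ∃ C, 0 < C ∧ ∀ n,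
      (∀ S, W.HasTrace t u n S → (∀ φ ∈ S, W.radius φ ≤ ρ) ∧ W.radiusCount ρ S ≤ K) →
      (W.A ^ n) u t ≤ C * (ρ ^ n * relativeGrowth θ K n) := by
  induction hN : {v | W.Reaches u v}.ncard using Nat.strong_induction_on generalizing u K with
  | _ N ihN =>
  have ih : ∀ K' y, W.Reaches u y → ¬ W.Reaches y u → ∃ C, 0 < C ∧ ∀ n,
      (∀ S, W.HasTrace t y n S → (∀ φ ∈ S, W.radius φ ≤ ρ) ∧ W.radiusCount ρ S ≤ K') →
      (W.A ^ n) y t ≤ C * (ρ ^ n * relativeGrowth θ K' n) := by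
    intro K' y huy hyu
    refine ihN _ ?_ y K' rfl
    rw [← hN]
    exact Set.ncard_lt_ncard ⟨fun v hv => huy.trans hv, fun h => hyu (h (.refl u))⟩
      (Set.toFinite _)
  set r := W.radius (W.scc u) with hr
  have hr0 : 0 ≤ r := radius_nonneg _ _
  by_cases htu : t ∈ W.scc u
  · obtain ⟨C, hC, hle⟩ := exists_pow_apply_le u t htu
    refine ⟨C, hC, fun n hn => ?_⟩
    have hg := relativeGrowth_pos hθ K n
    by_cases hpos : 0 < (W.A ^ n) u t
    swap
    · exact (not_lt.1 hpos).trans (by positivity)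
    obtain ⟨S, hS⟩ := exists_hasTrace hpos
    obtain ⟨h1, h2⟩ := hn S hS
    refine (hle n).trans (mul_le_mul_of_nonneg_left ?_ hC.le)
    rcases (h1 _ hS.scc_mem).lt_or_eq with hlt | heq
    · calc r ^ n ≤ (θ * ρ) ^ n := pow_le_pow_left₀ hr0 (hsep u hlt).le n
        _ = ρ ^ n * θ ^ n := by ring
        _ ≤ _ := by
          gcongr
          exact pow_le_relativeGrowth hθ hθ1 K n
    · have hK := radiusCount_pos (W := W) hS.scc_mem
      rw [heq] at hK ⊢
      obtain ⟨K, rfl⟩ : ∃ K', K = K' + 1 := ⟨K - 1, by omega⟩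
      exact le_mul_of_one_le_right (by positivity) (one_le_pow₀ (by simp))
  · rcases lt_trichotomy r ρ with hlt | heq | hgt
    · have hx : r / ρ < θ := (div_lt_iff₀ hρ).2 (hsep u hlt)
      refine exists_upper_bound_step hρ hθ htu (one_div_pos.2 (sub_pos.2 hx))
        (sum_pow_mul_relativeGrowth_le hθ1 (div_nonneg hr0 hρ.le) hx K) (fun S _ h => ?_) (ih K)
      rwa [radiusCount_insert_of_ne hlt.ne] at h
    · cases K with
      | zero =>
        refine ⟨1, one_pos, fun n hn => ?_⟩
        have hg := relativeGrowth_pos hθ 0 n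
        by_cases hpos : 0 < (W.A ^ n) u t
        swap
        · exact (not_lt.1 hpos).trans (by positivity)
        obtain ⟨S, hS⟩ := exists_hasTrace hpos
        have h1 := radiusCount_pos (W := W) hS.scc_mem
        rw [← hr, heq] at h1
        have h2 := (hn S hS).2
        omega
      | succ K =>
        refine exists_upper_bound_step hρ hθ htu (one_div_pos.2 (sub_pos.2 hθ1)) (fun n => ?_)
          (fun S hS h => ?_) (ih K)
        · rw [← hr, heq, div_self hρ.ne']
          simpa using sum_relativeGrowth_le hθ hθ1 K n
        · have hins := radiusCount_insert_of_eq (W := W) hS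
          rw [← hr, heq] at hins
          omega
    · refine ⟨1, one_pos, fun n hn => ?_⟩
      have hg := relativeGrowth_pos hθ K n
      by_cases hpos : 0 < (W.A ^ n) u t
      swap
      · exact (not_lt.1 hpos).trans (by positivity)
      obtain ⟨S, hS⟩ := exists_hasTrace hpos
      exact absurd ((hn S hS).1 _ hS.scc_mem) hgt.not_ge

theorem exists_upper_bound {ρ : ℝ} (hρ : 0 < ρ) (u t : Q) (K : ℕ) :
    ∃ C, 0 < C ∧ ∀ n, 0 < n →
      (∀ S, W.HasTrace t u n S → (∀ φ ∈ S, W.radius φ ≤ ρ) ∧ W.radiusCount ρ S ≤ K + 1) →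
      (W.A ^ n) u t ≤ C * (ρ ^ n * (n : ℝ) ^ K) := by
  obtain ⟨δ, hδ, hδle⟩ := Finite.exists_pos_le
    (fun q : {q // W.radius (W.scc q) < ρ} => 1 - W.radius (W.scc q) / ρ)
    (fun q => sub_pos.2 ((div_lt_one hρ).2 q.2))
  -- `θ = 1 - ε` lies strictly between `1` and all ratios `r / ρ < 1` of spectral radii.
  set ε := min δ 1 / 2 with hε
  have hε0 : 0 < ε := by positivity
  have hεδ : ε < δ := by
    have := min_le_left δ 1
    have : 0 < min δ 1 := by positivity
    rw [hε]
    linarith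
  have hε1 : ε < 1 := by
    have := min_le_right δ 1
    rw [hε]
    linarith
  obtain ⟨C, hC, hle⟩ := exists_upper_bound_relativeGrowth (W := W) (θ := 1 - ε) hρ (by linarith)
    (by linarith) (fun q hq => by
      have := hδle ⟨q, hq⟩
      rw [← div_lt_iff₀ hρ]
      linarith) t u (K + 1)
  refine ⟨C * 2 ^ K, by positivity, fun n hn h => (hle n h).trans ?_⟩
  have h1 : (n : ℝ) + 1 ≤ 2 * n := by
    have : (1 : ℝ) ≤ n := by exact_mod_cast hn
    linarith
  calc C * (ρ ^ n * ((n : ℝ) + 1) ^ K) ≤ C * (ρ ^ n * (2 * n) ^ K) := by gcongr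
    _ = _ := by ring

end UnaryWeightedAutomaton

namespace UnaryWeightedAutomaton

/-! ### The degree function -/

variable {Q : Type*} [Fintype Q] [DecidableEq Q] {W : UnaryWeightedAutomaton Q}

theorem degree_of_pow_apply_eq_zero {s t : Q} {n : ℕ} (h : (W.A ^ n) s t = 0) :
    W.degree s t n = (0, 0) :=
  if_neg fun hp => (exists_isPath_iff.1 hp).ne' h

/-- The suprema in the definition of the degree function are attained. -/
theorem degree_spec {s t : Q} {n : ℕ} (h : 0 < (W.A ^ n) s t) :
    (∃ q, (W.degree s t n).1 = W.radius (W.scc q)) ∧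
    (∀ S, W.HasTrace t s n S → (∀ φ ∈ S, W.radius φ ≤ (W.degree s t n).1) ∧
      W.radiusCount (W.degree s t n).1 S ≤ (W.degree s t n).2 + 1) ∧
    ∃ S, W.HasTrace t s n S ∧
      W.radiusCount (W.degree s t n).1 S = (W.degree s t n).2 + 1 := by
  have hex := exists_isPath_iff.2 h
  obtain ⟨p₀, hp₀⟩ := hex
  have hdeg : W.degree s t n =
      (W.maxRadius s t n, W.maxCount s t n (W.maxRadius s t n) - 1) := if_pos ⟨p₀, hp₀⟩
  rw [hdeg]
  dsimp only
  set X := {r | ∃ p, W.IsPath s t n p ∧ ∃ φ ∈ W.visited p, r = W.radius φ} with hX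
  have hXfin : X.Finite := (Set.finite_range W.radius).subset <| by
    rintro _ ⟨p, -, φ, -, rfl⟩
    exact ⟨φ, rfl⟩
  have hXmem : W.maxRadius s t n ∈ X :=
    Set.Nonempty.csSup_mem ⟨_, p₀, hp₀, _, ⟨0, rfl⟩, rfl⟩ hXfin
  have hXle : ∀ r ∈ X, r ≤ W.maxRadius s t n := fun r hr => le_csSup hXfin.bddAbove hr
  set ρ := W.maxRadius s t n
  set Y := {m | ∃ p, W.IsPath s t n p ∧ m = W.radiusCount ρ (W.visited p)} with hY
  have hYfin : Y.Finite := (Set.finite_range (W.radiusCount ρ)).subset <| by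
    rintro _ ⟨p, -, rfl⟩
    exact ⟨_, rfl⟩
  have hYmem : W.maxCount s t n ρ ∈ Y := Set.Nonempty.csSup_mem ⟨_, p₀, hp₀, rfl⟩ hYfin
  have hYle : ∀ m ∈ Y, m ≤ W.maxCount s t n ρ := fun m hm => le_csSup hYfin.bddAbove hm
  obtain ⟨p, hp, φ, hφ, hρφ⟩ := hXmem
  have hpos : 0 < W.maxCount s t n ρ := by
    have := hYle _ ⟨p, hp, rfl⟩
    have := radiusCount_pos (W := W) hφ
    rw [← hρφ] at this
    omega
  refine ⟨?_, fun S hS => ?_, ?_⟩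
  · obtain ⟨i, rfl⟩ := hφ
    exact ⟨p i, hρφ⟩
  · obtain ⟨p', hp', rfl⟩ := hS.exists_isPath
    have := hYle _ ⟨p', hp', rfl⟩
    exact ⟨fun φ hφ => hXle _ ⟨p', hp', φ, hφ, rfl⟩, by omega⟩
  · obtain ⟨p', hp', hcount⟩ := hYmem
    exact ⟨_, hp'.hasTrace, by omega⟩

theorem degree_fst_nonneg (s t : Q) (n : ℕ) : 0 ≤ (W.degree s t n).1 := by
  rcases (Matrix.pow_apply_nonneg W.nonneg n s t).eq_or_lt with h | h
  · rw [degree_of_pow_apply_eq_zero h.symm]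
  · obtain ⟨q, hq⟩ := (degree_spec h).1
    rw [hq]
    exact radius_nonneg _ _

theorem degree_snd_lt {s t : Q} {n : ℕ} (h : 0 < (W.A ^ n) s t) :
    (W.degree s t n).2 < Nat.card (Set Q) := by
  obtain ⟨-, -, S, -, hS⟩ := degree_spec h
  have : W.radiusCount (W.degree s t n).1 S ≤ Nat.card (Set Q) := by
    rw [← Set.ncard_univ]
    exact Set.ncard_le_ncard (Set.subset_univ _) (Set.toFinite _)
  omega

theorem finite_range_degree (W : UnaryWeightedAutomaton Q) (s t : Q) :
    (Set.range (W.degree s t)).Finite := by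
  refine (((Set.finite_range fun q => W.radius (W.scc q)).prod
    (Set.finite_Iio (Nat.card (Set Q)))).insert (0, 0)).subset ?_
  rintro _ ⟨n, rfl⟩
  rcases (Matrix.pow_apply_nonneg W.nonneg n s t).eq_or_lt with h | h
  · exact .inl (degree_of_pow_apply_eq_zero h.symm)
  · obtain ⟨q, hq⟩ := (degree_spec h).1
    exact .inr ⟨⟨q, hq.symm⟩, degree_snd_lt h⟩

theorem IsPath.pow_pos_between {s t : Q} {n : ℕ} {p : Fin (n + 1) → Q} (h : W.IsPath s t n p)
    (i k : ℕ) (hik : i + k < n + 1) :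
    0 < (W.A ^ k) (p ⟨i, by omega⟩) (p ⟨i + k, hik⟩) := by
  induction k with
  | zero => simp
  | succ k ih =>
    have h1 := h.2.2 ⟨i + k, by omega⟩
    exact pow_pos_trans (ih (by omega)) (by rw [pow_one]; exact h1)

/-- A path with more than `Fintype.card Q` transitions contains a closed path. -/
theorem degree_fst_pos {s t : Q} {n : ℕ} (hn : Fintype.card Q < n) (h : 0 < (W.A ^ n) s t) :
    0 < (W.degree s t n).1 := by
  obtain ⟨p, hp⟩ := exists_isPath_iff.2 h
  obtain ⟨i, j, hij, hpij⟩ : ∃ i j : Fin (n + 1), i < j ∧ p i = p j := by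
    obtain ⟨i, j, hne, heq⟩ := Fintype.exists_ne_map_eq_of_card_lt p (by simp; omega)
    rcases hne.lt_or_gt with h | h
    · exact ⟨i, j, h, heq⟩
    · exact ⟨j, i, h, heq.symm⟩
  have hij' : (i : ℕ) < j := hij
  have hcycle := hp.pow_pos_between i (j - i) (by omega)
  have hj : (⟨i + (j - i), by omega⟩ : Fin (n + 1)) = j := Fin.ext (by simp; omega)
  rw [hj, Fin.eta, ← hpij] at hcycle
  exact (radius_pos_of_cycle (by omega) hcycle).trans_le
    (((degree_spec h).2.1 _ hp.hasTrace).1 _ ⟨i, rfl⟩)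

theorem exists_bounds_degree (W : UnaryWeightedAutomaton Q) (s t : Q) :
    ∃ c C : ℝ, 0 < c ∧ 0 < C ∧ ∀ n : ℕ, Fintype.card Q < n →
      c * ((W.degree s t n).1 ^ n * (n : ℝ) ^ (W.degree s t n).2) ≤ (W.A ^ n) s t ∧
      (W.A ^ n) s t ≤ C * ((W.degree s t n).1 ^ n * (n : ℝ) ^ (W.degree s t n).2) := by
  obtain ⟨c, hc, hlower⟩ := exists_lower_bound W s t
  choose f hf hupper using
    fun x : {q // 0 < W.radius (W.scc q)} × Fin (Nat.card (Set Q)) =>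
      exists_upper_bound (W := W) x.1.2 s t x.2
  obtain ⟨C, hC, hle⟩ := Finite.exists_pos_ge f
  refine ⟨c, C, hc, hC, fun n hn => ?_⟩
  rcases (Matrix.pow_apply_nonneg W.nonneg n s t).eq_or_lt with h | h
  · rw [degree_of_pow_apply_eq_zero h.symm, ← h]
    simp [show n ≠ 0 by omega]
  have hpos := degree_fst_pos hn h
  have hlt := degree_snd_lt h
  obtain ⟨⟨q, hq⟩, hall, S, hS, hcount⟩ := degree_spec h
  generalize W.degree s t n = d at *
  obtain ⟨ρ, k⟩ := d
  dsimp only at *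
  subst hq
  refine ⟨hlower n S q k hS hpos hcount, ?_⟩
  refine (hupper (⟨q, hpos⟩, ⟨k, hlt⟩) n (by omega) hall).trans ?_
  exact mul_le_mul_of_nonneg_right (hle _) (by positivity)

/-! ### Comparing degrees -/

open Filter Asymptotics

theorem isLittleO_of_toLex_lt {d d' : ℝ × ℕ} (hd : 0 ≤ d.1) (h : toLex d < toLex d') :
    (fun n : ℕ => d.1 ^ n * (n : ℝ) ^ d.2) =o[atTop] fun n : ℕ => d'.1 ^ n * (n : ℝ) ^ d'.2 := by
  rcases Prod.Lex.toLex_lt_toLex.1 h with h | ⟨h1, h2⟩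
  · have h1 := isLittleO_pow_const_mul_const_pow_const_pow_of_norm_lt (R := ℝ) d.2
      (r₁ := d.1) (r₂ := d'.1) (by rwa [Real.norm_of_nonneg hd])
    simp only [mul_comm (_ ^ d.2)] at h1
    refine h1.trans_isBigO (IsBigO.of_bound 1 ?_)
    filter_upwards [eventually_ge_atTop 1] with n hn
    rw [one_mul, norm_mul]
    refine le_mul_of_one_le_right (norm_nonneg _) ?_
    rw [Real.norm_of_nonneg (by positivity)]
    exact one_le_pow₀ (by exact_mod_cast hn)
  · rw [h1]
    refine (isBigO_refl _ _).mul_isLittleO ?_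
    exact (isLittleO_pow_pow_atTop_of_lt h2).comp_tendsto tendsto_natCast_atTop_atTop

theorem isBigO_of_toLex_le {d d' : ℝ × ℕ} (hd : 0 ≤ d.1) (h : toLex d ≤ toLex d') :
    (fun n : ℕ => d.1 ^ n * (n : ℝ) ^ d.2) =O[atTop] fun n : ℕ => d'.1 ^ n * (n : ℝ) ^ d'.2 := by
  rcases h.lt_or_eq with h | h
  · exact (isLittleO_of_toLex_lt hd h).isBigO
  · rw [toLex_inj.1 h]

theorem weight_nonneg (W : UnaryWeightedAutomaton Q) (s : Q) (n : ℕ) : 0 ≤ W.weight s n :=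
  Matrix.pow_apply_nonneg W.nonneg n s W.final

theorem IsBigO.lc {s s' : Q} (h : W.IsBigO s s') : W.LC s s' := by
  obtain ⟨C, hC, hle⟩ := h
  exact fun n hn => pos_of_mul_pos_right (hn.trans_le (hle n)) hC.le

theorem IsBigO.eventually_degree_le {s s' : Q} (h : W.IsBigO s s') :
    ∀ᶠ n in atTop, toLex (W.degree s W.final n) ≤ toLex (W.degree s' W.final n) := by
  obtain ⟨C, hC, hle⟩ := h
  obtain ⟨c, C₁, hc, _, hs⟩ := exists_bounds_degree W s W.final
  obtain ⟨_, C', _, hC', hs'⟩ := exists_bounds_degree W s' W.final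
  have hsmall : ∀ᶠ n : ℕ in atTop, ∀ d ∈ Set.range (W.degree s W.final),
      ∀ d' ∈ Set.range (W.degree s' W.final), toLex d' < toLex d →
      ‖d'.1 ^ n * (n : ℝ) ^ d'.2‖ ≤ c / (2 * C * C') * ‖d.1 ^ n * (n : ℝ) ^ d.2‖ := by
    refine (eventually_all_finite (finite_range_degree W s _)).2 fun d _ =>
      (eventually_all_finite (finite_range_degree W s' _)).2 fun d' hd' => ?_
    by_cases hlt : toLex d' < toLex d
    · obtain ⟨m, rfl⟩ := hd'
      filter_upwards [(isLittleO_of_toLex_lt (degree_fst_nonneg _ _ _) hlt).def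
        (show 0 < c / (2 * C * C') by positivity)] with n hn _ using hn
    · exact Eventually.of_forall fun _ h => absurd h hlt
  filter_upwards [hsmall, eventually_gt_atTop (Fintype.card Q)] with n hn hcard
  by_contra! hlt
  have h1 := hn _ ⟨n, rfl⟩ _ ⟨n, rfl⟩ hlt
  have p1 := degree_fst_nonneg (W := W) s W.final n
  have p2 := degree_fst_nonneg (W := W) s' W.final n
  rw [Real.norm_of_nonneg (by positivity), Real.norm_of_nonneg (by positivity)] at h1
  have h2 := hs n hcard
  have h3 := (hs' n hcard).2
  have h4 := hle n
  simp only [weight] at h4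
  have h5 : 0 ≤ (W.degree s W.final n).1 ^ n * (n : ℝ) ^ (W.degree s W.final n).2 := by positivity
  set g := (W.degree s W.final n).1 ^ n * (n : ℝ) ^ (W.degree s W.final n).2
  set g' := (W.degree s' W.final n).1 ^ n * (n : ℝ) ^ (W.degree s' W.final n).2
  have h6 : c * g ≤ c / 2 * g := by
    calc c * g ≤ C * (C' * g') := h2.1.trans (h4.trans (mul_le_mul_of_nonneg_left h3 hC.le))
      _ ≤ C * (C' * (c / (2 * C * C') * g)) := by gcongr
      _ = c / 2 * g := by field_simp
  -- The two bounds are only compatible if both weights vanish, and then the degree at `s` is the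
  -- smallest possible, `(0, 0)`.
  have h7 : g = 0 := by nlinarith
  have h8 : (W.A ^ n) s W.final = 0 :=
    le_antisymm (by simpa [h7] using h2.2) (weight_nonneg W s n)
  rw [degree_of_pow_apply_eq_zero h8] at hlt
  rcases Prod.Lex.toLex_lt_toLex.1 hlt with h | ⟨-, h⟩
  · exact absurd p2 h.not_ge
  · exact absurd h (Nat.not_lt_zero _)

theorem isBigO_of_eventually_degree_le {s s' : Q} (hlc : W.LC s s')
    (h : ∀ᶠ n in atTop, toLex (W.degree s W.final n) ≤ toLex (W.degree s' W.final n)) :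
    W.IsBigO s s' := by
  obtain ⟨_, C, _, hC, hs⟩ := exists_bounds_degree W s W.final
  obtain ⟨c', _, hc', _, hs'⟩ := exists_bounds_degree W s' W.final
  have hfin := finite_range_degree W s W.final
  have hfin' := finite_range_degree W s' W.final
  have hpair : ∀ x : Set.range (W.degree s W.final) × Set.range (W.degree s' W.final),
      ∃ K, toLex x.1.1 ≤ toLex x.2.1 → ∀ᶠ n : ℕ in atTop,
        ‖x.1.1.1 ^ n * (n : ℝ) ^ x.1.1.2‖ ≤ K * ‖x.2.1.1 ^ n * (n : ℝ) ^ x.2.1.2‖ := by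
    rintro ⟨⟨_, m, rfl⟩, d'⟩
    by_cases hle : toLex (W.degree s W.final m) ≤ toLex d'.1
    · obtain ⟨K, hK⟩ := (isBigO_of_toLex_le (degree_fst_nonneg _ _ _) hle).bound
      exact ⟨K, fun _ => hK⟩
    · exact ⟨0, fun h => absurd h hle⟩
  choose K hK using hpair
  have := hfin.to_subtype
  have := hfin'.to_subtype
  obtain ⟨K₀, hK₀, hKle⟩ := Finite.exists_pos_ge K
  have hO : W.weight s =O[atTop] W.weight s' := by
    refine IsBigO.of_bound (C * K₀ / c') ?_
    have hall := eventually_all.2 fun x => eventually_imp_distrib_left.2 (hK x)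
    filter_upwards [h, hall, eventually_gt_atTop (Fintype.card Q)] with n hle hn hcard
    have h1 := hn (⟨_, n, rfl⟩, ⟨_, n, rfl⟩) hle
    have h1K := hKle (⟨_, n, rfl⟩, ⟨_, n, rfl⟩)
    have p1 := degree_fst_nonneg (W := W) s W.final n
    have p2 := degree_fst_nonneg (W := W) s' W.final n
    rw [Real.norm_of_nonneg (by positivity), Real.norm_of_nonneg (by positivity)] at h1
    rw [Real.norm_of_nonneg (weight_nonneg W s n), Real.norm_of_nonneg (weight_nonneg W s' n)]
    have h2 := (hs n hcard).2
    have h3 := (hs' n hcard).1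
    have h5 : 0 ≤ (W.degree s' W.final n).1 ^ n * (n : ℝ) ^ (W.degree s' W.final n).2 := by
      positivity
    simp only [weight]
    dsimp only at h1
    set g' := (W.degree s' W.final n).1 ^ n * (n : ℝ) ^ (W.degree s' W.final n).2
    rw [div_mul_eq_mul_div, le_div_iff₀ hc']
    calc (W.A ^ n) s W.final * c' ≤ C * (K₀ * g') * c' := by
          gcongr
          refine h2.trans (mul_le_mul_of_nonneg_left (h1.trans ?_) hC.le)
          exact mul_le_mul_of_nonneg_right h1K h5
      _ = C * K₀ * (c' * g') := by ring
      _ ≤ _ := by gcongr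
  obtain ⟨B, hB, hle⟩ := bound_of_isBigO_nat_atTop hO
  refine ⟨B, hB, fun n => ?_⟩
  by_cases h0 : W.weight s' n = 0
  · rw [h0, mul_zero]
    exact not_lt.1 fun hpos => (hlc n hpos).ne' h0
  · have := hle h0
    rwa [Real.norm_of_nonneg (weight_nonneg W s n),
      Real.norm_of_nonneg (weight_nonneg W s' n)] at this

end UnaryWeightedAutomaton

theorem lemma7p7 {Q : Type*} [Fintype Q] [DecidableEq Q] (W : UnaryWeightedAutomaton Q) :
    (∀ s t : Q, ∃ c C : ℝ, 0 < c ∧ 0 < C ∧ ∀ n : ℕ, Fintype.card Q < n →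
      c * ((W.degree s t n).1 ^ n * (n : ℝ) ^ (W.degree s t n).2) ≤ (W.A ^ n) s t ∧
      (W.A ^ n) s t ≤ C * ((W.degree s t n).1 ^ n * (n : ℝ) ^ (W.degree s t n).2)) ∧
    (∀ s s' : Q, W.IsBigO s s' ↔
      W.LC s s' ∧
        {n : ℕ | ¬ toLex (W.degree s W.final n) ≤ toLex (W.degree s' W.final n)}.Finite) := by
  refine ⟨W.exists_bounds_degree, fun s s' => ?_⟩
  have hfin : {n : ℕ | ¬ toLex (W.degree s W.final n) ≤ toLex (W.degree s' W.final n)}.Finite ↔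
      ∀ᶠ n in Filter.atTop,
        toLex (W.degree s W.final n) ≤ toLex (W.degree s' W.final n) := by
    rw [← Nat.cofinite_eq_atTop, Filter.eventually_cofinite]
  rw [hfin]
  exact ⟨fun h => ⟨h.lc, h.eventually_degree_le⟩,
    fun h => UnaryWeightedAutomaton.isBigO_of_eventually_degree_le h.1 h.2⟩
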